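/- **Setting.** Let $V$ be a finite set of nodes and let $\mathcal C$ be the set of tuples $(X,Y,\mathbf S)$ with $X\neq Y$ in $V$ and $\mathbf S\subseteq V\setminus\{X,Y\}$. Let $\mathcal K$ be a class of causal graphs on $V$, all of one of the following types, with the separation criterion belonging to the type: DAGs with $d$-separation, maximal ancestral graphs with $m$-separation, or (possibly cyclic) directed mixed graphs with $\sigma$-separation. Two graphs in $\mathcal K$ are Markov equivalent if the same tuples of $\mathcal C$ are separated in them. A PC-like (constraint-based) method $\mathcal M$ over $\mathcal K$ is a deterministic procedure that performs conditional independence (CI) tests on tuples of $\mathcal C$ one after the other, where each step may depend on the outcomes of the previous tests, and then returns an output graph $\mathcal G_{out}$. Either orientation conflicts or ambiguous unshielded triples are marked in $\mathcal G_{out}$, or $\mathcal G_{out}$ is unmarked and represents a Markov equivalence class of graphs in $\mathcal K$; in the latter case $\mathcal C^{sep}$ and $\mathcal C^{con}$ denote the tuples that are separated, respectively connected, in this class. A *result* of $\mathcal M$ is given by a true causal graph $\mathcal G_{true}$ (a mixed graph on $V$, not necessarily in $\mathcal K$), a probability distribution $\mathcal P$ on $\mathbb R^V$ of the variables, and a CI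 test outcome $\iota:\mathcal C\to\{0,1\}$ ($1$ for independent), which need not be correct. Running $\mathcal M$ with the outcomes $\iota$ determines the set $\mathcal T^{ind}$ of tuples that were tested with outcome $1$, the set $\mathcal T^{dep}$ of tuples that were tested with outcome $0$, and $\mathcal G_{out}$. * The result is *erroneous* if $\mathcal G_{out}$ is marked, or if $\mathcal G_{out}$ is unmarked and $\mathcal G_{true}$ does not belong to the Markov equivalence class that it represents. * The result is in *G1* if conflicts or ambiguities are marked in $\mathcal G_{out}$. It is in *G2* if $\mathcal G_{out}$ is unmarked and the result is incoherent, i.e. $\mathcal T^{ind}\not\subseteq\mathcal C^{sep}$ or $\mathcal T^{dep}\not\subseteq\mathcal C^{con}$. * The result is *error-free* if $\mathcal G_{true}\in\mathcal K$, $\mathcal P$ is Markovian and faithful to $\mathcal G_{true}$, for every tuple $(X,Y,\mathbf S)\in\mathcal C$ one has $\iota(X,Y,\mathbf S)=1$ if and only if $X$ and $Y$ are conditionally independent given $\mathbf S$ under $\mathcal P$, and the result is not erroneous. * An erroneous result is *internally detectable* if there is a detector, i.e. a predicate of $(\mathcal T^{ind},\mathcal T^{dep},\mathcal G_{out})$ alone,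 that holds for this result and holds for no error-free result of $\mathcal M$. **Proposition 2.** For every class $\mathcal K$ and every PC-like method $\mathcal M$ over $\mathcal K$ as above, the set of internally detectable erroneous results of $\mathcal M$ is exactly the set of those erroneous results that lie in G1 $\cup$ G2: the erroneous results with marked conflicts or ambiguities, together with the erroneous results that are free of marks but incoherent. -/

import Mathlib

open MeasureTheory ProbabilityTheory

/-- A statement `(x, y, S)`: two distinct nodes and a (possibly empty) set of further nodes.
The type `Stmt V` is the set of all such tuples over the node set `V`. -/
@[ext]
structure Stmt (V : Type*) where
  x : V
  y : V
  S : Finset V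
  ne : x ≠ y
  x_notMem : x ∉ S
  y_notMem : y ∉ S

/-! ### Causal graphs and separation -/

/-- A mixed graph: directed edges `u → v`, bidirected edges `u ↔ v`, undirected edges `u — v`. -/
@[ext]
structure MixedGraph (V : Type*) where
  dir : V → V → Prop
  bi : V → V → Prop
  und : V → V → Prop
  bi_symm : ∀ u v, bi u v → bi v u
  und_symm : ∀ u v, und u v → und v u
  bi_irrefl : ∀ v, ¬ bi v v
  und_irrefl : ∀ v, ¬ und v v

/-- The ways in which a walk can traverse an edge from a node `u` to a node `v`:
`u → v`, `u ← v`, `u ↔ v`, `u — v`. -/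
inductive EdgeKind
  | out
  | inn
  | bi
  | und

/-- There is an arrowhead at the node that the traversed edge leads to. -/
def EdgeKind.HeadAtTarget : EdgeKind → Prop
  | .out => True
  | .inn => False
  | .bi => True
  | .und => False

/-- There is an arrowhead at the node that the traversed edge comes from. -/
def EdgeKind.HeadAtSource : EdgeKind → Prop
  | .out => False
  | .inn => True
  | .bi => True
  | .und => False

/-- The separation criteria: `m`-separation (which on directed acyclic graphs is `d`-separation)
and `σ`-separation. -/
inductive Criterion
  | m
  | sigma

namespace MixedGraph

variable {V : Type*}

def Has (G : MixedGraph V) : EdgeKind → V → V → Prop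
  | .out, u, v => G.dir u v
  | .inn, u, v => G.dir v u
  | .bi, u, v => G.bi u v
  | .und, u, v => G.und u v

def Adjacent (G : MixedGraph V) (u v : V) : Prop := ∃ k, G.Has k u v

/-- `u` is an ancestor of `v`; every node is an ancestor of itself. -/
def Ancestor (G : MixedGraph V) (u v : V) : Prop := Relation.ReflTransGen G.dir u v

/-- `u` and `v` lie in the same strongly connected component. -/
def SameSCC (G : MixedGraph V) (u v : V) : Prop := G.Ancestor u v ∧ G.Ancestor v u

/-- The non-collider `v` on the walk segment `a -k- v -l- b` blocks the walk given `S`: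
for `m`-separation if `v ∈ S`; for `σ`-separation if moreover `v` points to a neighbour on the
segment that lies in a different strongly connected component. -/
def NonColliderBlocks (G : MixedGraph V) (S : Finset V) :
    Criterion → V → EdgeKind → V → EdgeKind → V → Prop
  | .m, _, _, v, _, _ => v ∈ S
  | .sigma, a, k, v, l, b =>
      v ∈ S ∧ ((k = .inn ∧ ¬ G.SameSCC v a) ∨ (l = .out ∧ ¬ G.SameSCC v b))

/-- The walk segment `a -k- v -l- b` is open given `S`: if `v` is a collider on it, then `v` is an
ancestor of a node in `S`; otherwise `v` does not block. -/
def SegmentOpen (G : MixedGraph V) (κ : Criterion) (S : Finset V)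
    (a : V) (k : EdgeKind) (v : V) (l : EdgeKind) (b : V) : Prop :=
  (k.HeadAtTarget ∧ l.HeadAtSource ∧ ∃ s ∈ S, G.Ancestor v s) ∨
    (¬ (k.HeadAtTarget ∧ l.HeadAtSource) ∧ ¬ G.NonColliderBlocks S κ a k v l b)

/-- `G.OpenWalk κ S u a k v`: there is a walk from `u` to `v` in `G` that is open given `S` (all its
inner segments are open) and whose last edge is traversed from `a` to `v` in the way `k`. -/
inductive OpenWalk (G : MixedGraph V) (κ : Criterion) (S : Finset V) (u : V) :
    V → EdgeKind → V → Prop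
  | single {k : EdgeKind} {v : V} : G.Has k u v → OpenWalk G κ S u u k v
  | step {a : V} {k : EdgeKind} {v : V} {l : EdgeKind} {b : V} :
      OpenWalk G κ S u a k v → G.Has l v b → G.SegmentOpen κ S a k v l b →
        OpenWalk G κ S u v l b

/-- The tuple `t = (x, y, S)` is separated in `G`: no walk from `x` to `y` is open given `S`. -/
def Sep (G : MixedGraph V) (κ : Criterion) (t : Stmt V) : Prop :=
  ¬ ∃ a k, G.OpenWalk κ t.S t.x a k t.y

def Acyclic (G : MixedGraph V) : Prop := ∀ v, ¬ Relation.TransGen G.dir v v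

def IsDAG (G : MixedGraph V) : Prop :=
  G.Acyclic ∧ (∀ u v, ¬ G.bi u v) ∧ (∀ u v, ¬ G.und u v)

/-- Ancestral graphs: no directed cycles, no almost directed cycles, and no arrowhead at an endpoint
of an undirected edge. -/
def IsAncestral (G : MixedGraph V) : Prop :=
  G.Acyclic ∧ (∀ u v, G.bi u v → ¬ G.Ancestor u v) ∧
    (∀ u v, G.und u v → ∀ w, ¬ G.dir w u ∧ ¬ G.bi w u)

/-- Maximal ancestral graphs: any two distinct non-adjacent nodes are `m`-separated by some set. -/
def IsMAG (G : MixedGraph V) : Prop :=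
  G.IsAncestral ∧
    ∀ u v, u ≠ v → ¬ G.Adjacent u v → ∃ t : Stmt V, t.x = u ∧ t.y = v ∧ G.Sep .m t

/-- Directed mixed graphs: directed (possibly cyclic) graphs, possibly with bidirected edges. -/
def IsDirectedMixed (G : MixedGraph V) : Prop := ∀ u v, ¬ G.und u v

end MixedGraph

/-- The types of causal graphs. -/
inductive GraphType
  | dag
  | mag
  | cyclic

namespace GraphType

/-- `d`-separation for DAGs, `m`-separation for MAGs, `σ`-separation for cyclic graphs. -/
def criterion : GraphType → Criterion
  | .dag => .m
  | .mag => .m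
  | .cyclic => .sigma

def Admits {V : Type*} : GraphType → MixedGraph V → Prop
  | .dag, G => G.IsDAG
  | .mag, G => G.IsMAG
  | .cyclic, G => G.IsDirectedMixed

end GraphType

/-- The class of causal graphs that a method considers: some (possibly all) graphs of a given type,
with the separation criterion that belongs to the type. -/
structure GraphClass (V : Type*) where
  type : GraphType
  graphs : Set (MixedGraph V)
  admits : ∀ G ∈ graphs, type.Admits G

namespace GraphClass

variable {V : Type*}

def Sep (𝒦 : GraphClass V) (G : MixedGraph V) (t : Stmt V) : Prop := G.Sep 𝒦.type.criterion t

/-- Two graphs of the class are Markov equivalent if they have the same separations. -/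
def MarkovEquiv (𝒦 : GraphClass V) (G H : MixedGraph V) : Prop :=
  G ∈ 𝒦.graphs ∧ H ∈ 𝒦.graphs ∧ ∀ t, 𝒦.Sep G t ↔ 𝒦.Sep H t

/-- The Markov equivalence classes of graphs in `𝒦` (what CPDAGs and PAGs represent). -/
def MEC (𝒦 : GraphClass V) : Type _ :=
  {c : Set (MixedGraph V) // ∃ G ∈ 𝒦.graphs, c = {H | 𝒦.MarkovEquiv G H}}

/-- The separated tuples of a Markov equivalence class. -/
def MEC.sep {𝒦 : GraphClass V} (c : 𝒦.MEC) : Set (Stmt V) := {t | ∀ G ∈ c.1, 𝒦.Sep G t}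

/-- The connected tuples of a Markov equivalence class. -/
def MEC.con {𝒦 : GraphClass V} (c : 𝒦.MEC) : Set (Stmt V) := {t | ∀ G ∈ c.1, ¬ 𝒦.Sep G t}

end GraphClass

/-! ### Distributions -/

section Distributions

variable {V : Type*} [Fintype V]

/-- `X_x` and `X_y` are conditionally independent given `(X_s)_{s ∈ S}` under the distribution `P`
of the random vector `(X_v)_{v ∈ V}`. -/
def CondIndepIn (P : ProbabilityMeasure (V → ℝ)) (t : Stmt V) : Prop :=
  CondIndepFun (MeasurableSpace.comap (fun (ω : V → ℝ) (s : t.S) => ω s) inferInstance)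
    (Measurable.comap_le (by fun_prop)) (fun ω => ω t.x) (fun ω => ω t.y) (P : Measure (V → ℝ))

def IsMarkovian (P : ProbabilityMeasure (V → ℝ)) (𝒦 : GraphClass V) (G : MixedGraph V) : Prop :=
  ∀ t, 𝒦.Sep G t → CondIndepIn P t

def IsFaithful (P : ProbabilityMeasure (V → ℝ)) (𝒦 : GraphClass V) (G : MixedGraph V) : Prop :=
  ∀ t, CondIndepIn P t → 𝒦.Sep G t

end Distributions

/-! ### Constraint-based methods and their results -/

/-- End marks of edges in an output graph with marks: tail, arrowhead, undetermined, and the mark of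
an orientation conflict. -/
inductive EndMark
  | tail
  | head
  | circle
  | conflict

/-- An output graph in which orientation conflicts or ambiguities are marked. `mark u v` is the end
mark at `v` of the edge between `u` and `v`, and `none` if there is no such edge; `ambiguous` is the
set of unshielded triples that are marked as ambiguous. -/
structure MarkedGraph (V : Type*) where
  mark : V → V → Option EndMark
  mark_symm : ∀ u v, mark u v = none → mark v u = none
  mark_self : ∀ v, mark v v = none
  ambiguous : Set (V × V × V)
  unshielded : ∀ a b c, (a, b, c) ∈ ambiguous →
    a ≠ c ∧ mark a b ≠ none ∧ mark b c ≠ none ∧ mark a c = none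
  is_marked : (∃ u v, mark u v = some .conflict) ∨ ambiguous.Nonempty

/-- Output graphs: without marks the output graph represents a Markov equivalence class of the
considered graphs; otherwise conflicts or ambiguities are marked in it. -/
inductive OutputGraph {V : Type*} (𝒦 : GraphClass V)
  | unmarked (c : 𝒦.MEC)
  | marked (g : MarkedGraph V)

/-- A constraint-based (PC-like) method over the graph class `𝒦`: a deterministic procedure that
performs CI tests one after the other, where the next step may depend on the outcomes of the
previous tests (independent or dependent), and finally returns an output graph. -/
inductive Method {V : Type*} (𝒦 : GraphClass V)
  | output (g : OutputGraph 𝒦)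
  | test (t : Stmt V) (ifIndep ifDep : Method 𝒦)

namespace Method

variable {V : Type*} {𝒦 : GraphClass V}

/-- The tuples that are tested when the tests return the values of `ι`
(`true`: tested independent, `false`: tested dependent). -/
def tested (ι : Stmt V → Bool) : Method 𝒦 → Set (Stmt V)
  | .output _ => ∅
  | .test t p q => insert t (if ι t = true then p.tested ι else q.tested ι)

/-- The output graph when the tests return the values of `ι`. -/
def out (ι : Stmt V → Bool) : Method 𝒦 → OutputGraph 𝒦
  | .output g => g
  | .test t p q => if ι t = true then p.out ι else q.out ι

end Method

/-- A result of a method: the unknown ground truth, consisting of the true causal graph (which need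
not be of the considered class) and the distribution of the variables, and the outcomes of the CI
test, which need not be correct. Tested tuples and output graph are determined by the method. -/
structure MethodResult (V : Type*) [Fintype V] where
  trueGraph : MixedGraph V
  dist : ProbabilityMeasure (V → ℝ)
  ciTest : Stmt V → Bool

namespace MethodResult

variable {V : Type*} [Fintype V] {𝒦 : GraphClass V}

def outGraph (M : Method 𝒦) (r : MethodResult V) : OutputGraph 𝒦 := M.out r.ciTest

/-- The tuples that were tested independent. -/
def Tind (M : Method 𝒦) (r : MethodResult V) : Set (Stmt V) :=
  {t | t ∈ M.tested r.ciTest ∧ r.ciTest t = true}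

/-- The tuples that were tested dependent. -/
def Tdep (M : Method 𝒦) (r : MethodResult V) : Set (Stmt V) :=
  {t | t ∈ M.tested r.ciTest ∧ r.ciTest t = false}

/-- The output graph has marked conflicts or ambiguities, or it is not Markov equivalent to the
true causal graph. -/
def Erroneous (M : Method 𝒦) (r : MethodResult V) : Prop :=
  match r.outGraph M with
  | .unmarked c => r.trueGraph ∉ c.1
  | .marked _ => True

/-- Orientation conflicts or ambiguities are marked in the output graph. -/
def G1 (M : Method 𝒦) : Set (MethodResult V) := {r | ∃ g, r.outGraph M = .marked g}

/-- No conflicts or ambiguities are marked in the output graph, but the result is incoherent. -/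
def G2 (M : Method 𝒦) : Set (MethodResult V) :=
  {r | ∃ c, r.outGraph M = .unmarked c ∧ (¬ r.Tind M ⊆ c.sep ∨ ¬ r.Tdep M ⊆ c.con)}

/-- A result without any error: the true causal graph belongs to the considered class, the
distribution is Markovian and faithful to it, the CI test decides conditional independence
correctly, and the result is not erroneous. -/
structure ErrorFree (M : Method 𝒦) (r : MethodResult V) : Prop where
  mem_graphs : r.trueGraph ∈ 𝒦.graphs
  markovian : IsMarkovian r.dist 𝒦 r.trueGraph
  faithful : IsFaithful r.dist 𝒦 r.trueGraph
  test_correct : ∀ t, r.ciTest t = true ↔ CondIndepIn r.dist t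
  not_erroneous : ¬ r.Erroneous M

/-- The erroneous result `r` is internally detectable: some detector `D` that accesses nothing but
the results of the performed tests and the output graph raises an alarm on `r`, while it never
raises an alarm on an error-free result of the method. -/
def InternallyDetectable (M : Method 𝒦) (r : MethodResult V) : Prop :=
  r.Erroneous M ∧
    ∃ D : Set (Stmt V) → Set (Stmt V) → OutputGraph 𝒦 → Prop,
      D (r.Tind M) (r.Tdep M) (r.outGraph M) ∧
        ∀ r' : MethodResult V, r'.ErrorFree M →
          ¬ D (r'.Tind M) (r'.Tdep M) (r'.outGraph M)

end MethodResult

/-! An error-free result is never marked, and being Markovian, faithful and correctly tested makes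
it coherent with its class; so "marked or incoherent" is itself a valid detector.

For the converse, take an unmarked coherent result and any graph `G` of its output class. If `G` has
a Markovian and faithful distribution `P`, then `G`, `P` and the true separations of `G` form an
error-free result. By coherence its tests agree with all performed ones, so the run is the same
(`Method.run_congr`) and every detector sees the same data.

The real work is the existence of `P` (`GraphClass.exists_condIndepIn_iff_sep`), obtained from
uniform distributions on finite groups. If each variable is the coset of a uniform element modulo a
subgroup, conditional independence becomes a decomposition property of subgroups
(`condIndepIn_cosetDist_iff`). For each connected tuple, choose a walk whose colliders are exactly
its inner nodes in the conditioning set. Put one fair bit on every maximal collider-free stretch;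
colliders observe the sum of the two adjacent bits, the other positions their own bit. This
distribution is Markovian for the whole graph and makes the chosen tuple dependent. The product over
all tuples has exactly the conditional independences common to the factors, hence is faithful.

This settles `m`-separation in arbitrary mixed graphs. For `σ`-separation, pass to the
acyclification, whose `m`-separations are the `σ`-separations of `G` (`sep_acyclification_iff`). -/

/-! ### Conditional independence for cosets of subgroups of a finite group -/

/-- For a uniformly distributed element of the group `Ω` and the random cosets of the subgroups
`K v`, this expresses that the cosets of `K x` and `K y` are conditionally independent given those
of `K s`, `s ∈ S`. -/
def SubgroupsSplit {V Ω : Type*} [AddCommGroup Ω] (K : V → AddSubgroup Ω) (t : Stmt V) : Prop :=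
  ∀ δ, (∀ s ∈ t.S, δ ∈ K s) → ∃ δ', (∀ s ∈ t.S, δ' ∈ K s) ∧ δ' ∈ K t.y ∧ δ - δ' ∈ K t.x

section Counting

variable {Ω : Type*} [AddCommGroup Ω]

/-- Within a coset of `K`, sets that are invariant under complementary subgroups of `K` are
independent. -/
theorem card_inter_mul_card_of_invariant (K A B : Set Ω) (θ₀ : Ω)
    (hA : ∀ a ∈ A, a - θ₀ ∈ K) (hB : ∀ b ∈ B, b - θ₀ ∈ K)
    (hsub : ∀ a b, a - θ₀ ∈ K → b - θ₀ ∈ K → a - b ∈ K)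
    (hK : ∀ k ∈ K, ∃ k₁ k₂, k₁ + k₂ = k ∧ (∀ θ, θ ∈ A ↔ θ + k₁ ∈ A) ∧
      (∀ θ, θ ∈ B ↔ θ + k₂ ∈ B)) :
    Nat.card A * Nat.card B = Nat.card (A ∩ B : Set Ω) * Nat.card K := by
  classical
  choose! k₁ k₂ hk h₁ h₂ using hK
  rw [← Nat.card_prod, ← Nat.card_prod]
  have inv₁ : ∀ k ∈ K, ∀ θ, θ ∈ A ↔ θ - k₁ k ∈ A := fun k hkK θ => by
    rw [h₁ k hkK (θ - k₁ k), sub_add_cancel]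
  have inv₂ : ∀ k ∈ K, ∀ θ, θ ∈ B ↔ θ - k₂ k ∈ B := fun k hkK θ => by
    rw [h₂ k hkK (θ - k₂ k), sub_add_cancel]
  have mem : ∀ p : A × B, (p.1 : Ω) - p.2 ∈ K := fun p =>
    hsub _ _ (hA _ p.1.2) (hB _ p.2.2)
  -- The bijection sends `(a, b)` to `(a - k₁, a - b)`, where `a - b = k₁ + k₂`. The point `a - k₁ =
  -- b + k₂` lies in `A` by the first expression and in `B` by the second.
  refine Nat.card_congr
    { toFun := fun p => (⟨p.1 - k₁ (p.1 - p.2), (inv₁ _ (mem p) _).1 p.1.2, ?_⟩,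
        ⟨p.1 - p.2, mem p⟩)
      invFun := fun p => (⟨p.1 + k₁ p.2, (h₁ _ p.2.2 _).1 p.1.2.1⟩,
        ⟨p.1 - k₂ p.2, (inv₂ _ p.2.2 _).1 p.1.2.2⟩)
      left_inv := ?_
      right_inv := ?_ }
  · have e : (p.1 : Ω) - k₁ (p.1 - p.2) = p.2 + k₂ (p.1 - p.2) := by
      have := hk _ (mem p)
      rw [sub_eq_iff_eq_add, add_assoc, add_comm (k₂ _), this]; abel
    rw [e]
    exact (h₂ _ (mem p) _).1 p.2.2
  · intro p
    have := hk _ (mem p)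
    ext
    · simp
    · simp only
      have e : (p.1 : Ω) = p.2 + (k₁ (p.1 - p.2) + k₂ (p.1 - p.2)) := by rw [this]; abel
      rw [sub_sub, sub_eq_iff_eq_add]
      exact e
  · intro p
    have := hk _ p.2.2
    have e : ((p.1 : Ω) + k₁ p.2) - (p.1 - k₂ p.2) = p.2 := by
      rw [add_sub_sub_cancel, this]
    ext
    · simp [e]
    · simp [e]

end Counting

/-! ### Conditioning on a random variable whose fibres are almost surely atoms. -/

/-- On an atom, the conditional probability given a random variable is the elementary one. -/
theorem measureReal_fiber_mul_condExp_indicator {α β : Type*} [mα : MeasurableSpace α]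
    [mβ : MeasurableSpace β] [MeasurableSingletonClass β] (μ : Measure α) [IsProbabilityMeasure μ]
    (f : α → β) (hf : Measurable f) (A : Set α) (hA : MeasurableSet A) (ω : α) :
    μ.real (f ⁻¹' {f ω}) * (μ⟦A | MeasurableSpace.comap f mβ⟧) ω =
      μ.real (A ∩ f ⁻¹' {f ω}) := by
  have hle : MeasurableSpace.comap f mβ ≤ mα := hf.comap_le
  have hE : MeasurableSet[MeasurableSpace.comap f mβ] (f ⁻¹' {f ω}) :=
    ⟨_, measurableSet_singleton _, rfl⟩
  -- Measurability with respect to `f` makes the conditional probability constant on the fibre, so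
  -- its integral there is this constant times the mass of the fibre.
  have hconst := (stronglyMeasurable_condExp (μ := μ) (m := MeasurableSpace.comap f mβ)
    (f := A.indicator fun _ => (1 : ℝ))).factorsThrough
  have hint := setIntegral_condExp (μ := μ) hle
    ((integrable_const (1 : ℝ)).indicator hA) hE
  rw [setIntegral_congr_fun (g := fun _ => (μ⟦A | MeasurableSpace.comap f mβ⟧) ω) (hle _ hE)
    (fun z hz => hconst hz), setIntegral_const, integral_indicator hA,
    Measure.restrict_restrict hA, setIntegral_const] at hint
  simpa using hint

theorem condIndepFun_comap_iff {α β γ γ' : Type*} [mα : MeasurableSpace α] [StandardBorelSpace α]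
    [mβ : MeasurableSpace β] [MeasurableSingletonClass β] [MeasurableSpace γ] [MeasurableSpace γ']
    (μ : Measure α) [IsProbabilityMeasure μ] (f : α → β) (hf : Measurable f)
    (hμ : ∀ᵐ ω ∂μ, μ.real (f ⁻¹' {f ω}) ≠ 0)
    (g : α → γ) (hg : Measurable g) (h : α → γ') (hh : Measurable h) :
    CondIndepFun (MeasurableSpace.comap f mβ) hf.comap_le g h μ ↔
      ∀ s t, MeasurableSet s → MeasurableSet t → ∀ᵐ ω ∂μ,
        μ.real (g ⁻¹' s ∩ f ⁻¹' {f ω}) * μ.real (h ⁻¹' t ∩ f ⁻¹' {f ω}) =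
          μ.real (g ⁻¹' s ∩ h ⁻¹' t ∩ f ⁻¹' {f ω}) * μ.real (f ⁻¹' {f ω}) := by
  rw [condIndepFun_iff_condExp_inter_preimage_eq_mul hg hh]
  refine forall₄_congr fun s t hs ht => Filter.eventually_congr ?_
  filter_upwards [hμ] with ω hω
  rw [← measureReal_fiber_mul_condExp_indicator μ f hf _ (hg hs),
    ← measureReal_fiber_mul_condExp_indicator μ f hf _ (hh ht),
    ← measureReal_fiber_mul_condExp_indicator μ f hf _ ((hg hs).inter (hh ht))]
  constructor
  · intro e
    rw [e]; ring
  · intro e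
    have h2 : μ.real (f ⁻¹' {f ω}) * μ.real (f ⁻¹' {f ω}) ≠ 0 := mul_ne_zero hω hω
    apply mul_left_cancel₀ h2
    linear_combination -e

/-! ### Joint distributions of random cosets. -/

section CosetDistribution

variable {V Ω : Type*} [AddCommGroup Ω] [Finite Ω]

/-- An encoding of the coset of `K v` by a real number. -/
noncomputable def cosetCode (K : V → AddSubgroup Ω) (θ : Ω) (v : V) : ℝ :=
  ((Finite.equivFin (Ω ⧸ K v) (θ : Ω ⧸ K v) : ℕ) : ℝ)

theorem cosetCode_eq_iff (K : V → AddSubgroup Ω) (θ θ' : Ω) (v : V) :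
    cosetCode K θ v = cosetCode K θ' v ↔ θ - θ' ∈ K v := by
  simp only [cosetCode, Nat.cast_inj, Fin.val_inj, EmbeddingLike.apply_eq_iff_eq]
  rw [eq_comm, QuotientAddGroup.eq, neg_add_eq_sub]

/-- The joint distribution of the cosets of the subgroups `K v` that contain a uniformly distributed
element. -/
noncomputable def cosetDist (K : V → AddSubgroup Ω) : ProbabilityMeasure (V → ℝ) :=
  letI : MeasurableSpace Ω := ⊤
  ⟨(uniformOn (Set.univ : Set Ω)).map (cosetCode K),
    haveI := isProbabilityMeasure_uniformOn (s := (Set.univ : Set Ω)) Set.finite_univ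
      Set.univ_nonempty
    Measure.isProbabilityMeasure_map (measurable_from_top).aemeasurable⟩

theorem cosetDist_real (K : V → AddSubgroup Ω) (E : Set (V → ℝ)) (hE : MeasurableSet E) :
    (cosetDist K : Measure (V → ℝ)).real E = Nat.card (cosetCode K ⁻¹' E) / Nat.card Ω := by
  classical
  let _ : MeasurableSpace Ω := ⊤
  let _ := Fintype.ofFinite Ω
  change ((uniformOn (Set.univ : Set Ω)).map (cosetCode K)).real E = _
  rw [map_measureReal_apply measurable_from_top hE, measureReal_def, uniformOn_univ,
    Measure.count_apply MeasurableSpace.measurableSet_top, ENNReal.toReal_div]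
  simp [Set.encard, Nat.card]

theorem cosetDist_real_ne_zero (K : V → AddSubgroup Ω) (E : Set (V → ℝ)) (hE : MeasurableSet E)
    {θ : Ω} (hθ : cosetCode K θ ∈ E) : (cosetDist K : Measure (V → ℝ)).real E ≠ 0 := by
  rw [cosetDist_real K E hE]
  have : Nonempty (cosetCode K ⁻¹' E) := ⟨⟨θ, hθ⟩⟩
  exact div_ne_zero (Nat.cast_ne_zero.2 Nat.card_pos.ne') (Nat.cast_ne_zero.2 Nat.card_pos.ne')

variable [Fintype V]

theorem ae_cosetDist_iff (K : V → AddSubgroup Ω) (p : (V → ℝ) → Prop) :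
    (∀ᵐ ω ∂(cosetDist K : Measure (V → ℝ)), p ω) ↔ ∀ θ, p (cosetCode K θ) := by
  constructor
  · intro h θ
    by_contra hθ
    refine cosetDist_real_ne_zero K {cosetCode K θ} (measurableSet_singleton _) rfl ?_
    rw [measureReal_eq_zero_iff]
    refine measure_mono_null ?_ (ae_iff.1 h)
    rintro _ rfl
    exact hθ
  · intro h
    have hr : MeasurableSet (Set.range (cosetCode K))ᶜ :=
      (Set.finite_range (cosetCode K)).measurableSet.compl
    rw [ae_iff]
    refine measure_mono_null (t := (Set.range (cosetCode K))ᶜ) ?_ ?_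
    · rintro ω hω ⟨θ, rfl⟩
      exact hω (h θ)
    · rw [← measureReal_eq_zero_iff, cosetDist_real K _ hr]
      simp

/-- Fibres of the conditioning variables are cosets of the intersection of the `K s`, so
independence on a fibre is a counting identity for unions of cosets. -/
theorem condIndepIn_cosetDist_iff (K : V → AddSubgroup Ω) (t : Stmt V) :
    CondIndepIn (cosetDist K) t ↔ SubgroupsSplit K t := by
  have hf : Measurable (fun (ω : V → ℝ) (s : t.S) => ω s) := by fun_prop
  have hfib : ∀ ω : V → ℝ, MeasurableSet ((fun (ω : V → ℝ) (s : t.S) => ω s) ⁻¹'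
      {fun s : t.S => ω s}) := fun ω => hf (measurableSet_singleton _)
  have hx : Measurable (fun ω : V → ℝ => ω t.x) := by fun_prop
  have hy : Measurable (fun ω : V → ℝ => ω t.y) := by fun_prop
  have hpre : ∀ θ₀, cosetCode K ⁻¹' ((fun (ω : V → ℝ) (s : t.S) => ω s) ⁻¹'
      {fun s : t.S => cosetCode K θ₀ s}) = {θ | ∀ s ∈ t.S, θ - θ₀ ∈ K s} := by
    intro θ₀
    ext θ
    simp [funext_iff, cosetCode_eq_iff]
  have hc : (Nat.card Ω : ℝ) ≠ 0 := Nat.cast_ne_zero.2 Nat.card_pos.ne'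
  rw [CondIndepIn, condIndepFun_comap_iff _ _ hf
    ((ae_cosetDist_iff K _).2 fun θ => cosetDist_real_ne_zero K _ (hfib _) (θ := θ) rfl) _ hx _ hy]
  have key : ∀ (s u : Set ℝ), MeasurableSet s → MeasurableSet u → ∀ θ₀ : Ω,
      ((cosetDist K : Measure (V → ℝ)).real ((fun ω : V → ℝ => ω t.x) ⁻¹' s ∩
          (fun (ω : V → ℝ) (s : t.S) => ω s) ⁻¹' {fun s : t.S => cosetCode K θ₀ s}) *
        (cosetDist K : Measure (V → ℝ)).real ((fun ω : V → ℝ => ω t.y) ⁻¹' u ∩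
          (fun (ω : V → ℝ) (s : t.S) => ω s) ⁻¹' {fun s : t.S => cosetCode K θ₀ s}) =
        (cosetDist K : Measure (V → ℝ)).real
          ((fun ω : V → ℝ => ω t.x) ⁻¹' s ∩ (fun ω : V → ℝ => ω t.y) ⁻¹' u ∩
          (fun (ω : V → ℝ) (s : t.S) => ω s) ⁻¹' {fun s : t.S => cosetCode K θ₀ s}) *
        (cosetDist K : Measure (V → ℝ)).real
          ((fun (ω : V → ℝ) (s : t.S) => ω s) ⁻¹' {fun s : t.S => cosetCode K θ₀ s})) ↔
      Nat.card ({θ | cosetCode K θ t.x ∈ s} ∩ {θ | ∀ s ∈ t.S, θ - θ₀ ∈ K s} : Set Ω) *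
        Nat.card ({θ | cosetCode K θ t.y ∈ u} ∩ {θ | ∀ s ∈ t.S, θ - θ₀ ∈ K s} : Set Ω) =
      Nat.card ({θ | cosetCode K θ t.x ∈ s} ∩ {θ | cosetCode K θ t.y ∈ u} ∩
          {θ | ∀ s ∈ t.S, θ - θ₀ ∈ K s} : Set Ω) *
        Nat.card ({θ | ∀ s ∈ t.S, θ - θ₀ ∈ K s} : Set Ω) := by
    intro s u hs hu θ₀
    rw [cosetDist_real K _ ((hx hs).inter (hfib _)), cosetDist_real K _ ((hy hu).inter (hfib _)),
      cosetDist_real K _ (((hx hs).inter (hy hu)).inter (hfib _)), cosetDist_real K _ (hfib _)]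
    simp only [Set.preimage_inter, hpre]
    rw [div_mul_div_comm, div_mul_div_comm, div_left_inj' (mul_ne_zero hc hc)]
    norm_cast
  constructor
  -- On the fibre of `0`, the events "same `x`-coset as `δ`" and "same `y`-coset as `0`" both occur.
  -- Independence makes them occur jointly, and a common point serves as `δ'`.
  · intro h δ hδ
    have e := (key _ _ (measurableSet_singleton _) (measurableSet_singleton _) 0).1
      ((ae_cosetDist_iff K _).1 (h {cosetCode K δ t.x} {cosetCode K 0 t.y}
        (measurableSet_singleton _) (measurableSet_singleton _)) 0)
    have h1 : Nonempty ({θ | cosetCode K θ t.x ∈ ({cosetCode K δ t.x} : Set ℝ)} ∩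
        {θ | ∀ s ∈ t.S, θ - 0 ∈ K s} : Set Ω) := ⟨⟨δ, rfl, by simpa using hδ⟩⟩
    have h2 : Nonempty ({θ | cosetCode K θ t.y ∈ ({cosetCode K 0 t.y} : Set ℝ)} ∩
        {θ | ∀ s ∈ t.S, θ - 0 ∈ K s} : Set Ω) := ⟨⟨0, rfl, by simp [zero_mem]⟩⟩
    have h3 := left_ne_zero_of_mul
      (e ▸ mul_ne_zero (Nat.card_pos (α := _)).ne' (Nat.card_pos (α := _)).ne')
    obtain ⟨⟨θ, ⟨hθx, hθy⟩, hθ⟩⟩ := (Nat.card_ne_zero.1 h3).1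
    simp only [Set.mem_ofPred_eq, Set.mem_singleton_iff, cosetCode_eq_iff, sub_zero]
      at hθx hθy hθ
    exact ⟨θ, hθ, hθy, by simpa using neg_mem hθx⟩
  · intro h s u hs hu
    refine (ae_cosetDist_iff K _).2 fun θ₀ => (key s u hs hu θ₀).2 ?_
    have hcard : Nat.card ({θ | ∀ s ∈ t.S, θ - θ₀ ∈ K s} : Set Ω) =
        Nat.card ({θ | ∀ s ∈ t.S, θ ∈ K s} : Set Ω) :=
      Nat.card_congr
        { toFun := fun θ => ⟨θ - θ₀, θ.2⟩
          invFun := fun θ => ⟨θ + θ₀, fun s hs => by simpa using θ.2 s hs⟩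
          left_inv := fun θ => by simp
          right_inv := fun θ => by simp }
    have inv : ∀ v, ∀ k ∈ K v, ∀ θ, cosetCode K (θ + k) v = cosetCode K θ v := fun v k hk θ =>
      (cosetCode_eq_iff K _ _ v).2 (by simpa using hk)
    rw [hcard, card_inter_mul_card_of_invariant {θ | ∀ s ∈ t.S, θ ∈ K s} _ _ θ₀
      (fun a ha => ha.2) (fun b hb => hb.2)
      (fun a b ha hb s hs => by simpa using sub_mem (ha s hs) (hb s hs)) ?_,
      ← Set.inter_inter_distrib_right]
    -- Translation by `k - k'` preserves the event at `x` and translation by `k'` the event at `y`;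
    -- both preserve the fibre.
    intro k hk
    obtain ⟨k', hk', hky, hkx⟩ := h k hk
    have inv' : ∀ l, (∀ s ∈ t.S, l ∈ K s) → ∀ θ,
        (∀ s ∈ t.S, θ - θ₀ ∈ K s) ↔ ∀ s ∈ t.S, θ + l - θ₀ ∈ K s := by
      intro l hl θ
      refine forall₂_congr fun s hs => ?_
      rw [add_sub_right_comm, AddSubgroup.add_mem_cancel_right _ (hl s hs)]
    refine ⟨k - k', k', sub_add_cancel _ _, fun θ => ?_, fun θ => ?_⟩
    · simp only [Set.mem_inter_iff, Set.mem_ofPred_eq, inv _ _ hkx]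
      rw [← inv' _ fun s hs => sub_mem (hk s hs) (hk' s hs)]
    · simp only [Set.mem_inter_iff, Set.mem_ofPred_eq, inv _ _ hky]
      rw [← inv' _ hk']

end CosetDistribution

/-! ### A distribution that is Markovian and faithful for `m`-separation -/

theorem Stmt.finite (V : Type*) [Finite V] : Finite (Stmt V) :=
  Finite.of_injective (fun t : Stmt V => (t.x, t.y, t.S)) fun t t' h => by
    simp only [Prod.mk.injEq] at h
    exact Stmt.ext h.1 h.2.1 h.2.2

/-- In a product of subgroups, splitting can be checked in each factor. -/
theorem subgroupsSplit_pi_iff {V I : Type*} {Ω : I → Type*} [∀ i, AddCommGroup (Ω i)]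
    (K : ∀ i, V → AddSubgroup (Ω i)) (t : Stmt V) :
    SubgroupsSplit (fun v => AddSubgroup.pi Set.univ fun i => K i v) t ↔
      ∀ i, SubgroupsSplit (K i) t := by
  classical
  simp only [SubgroupsSplit, AddSubgroup.mem_pi, Set.mem_univ, true_imp_iff]
  constructor
  · intro h i δ hδ
    obtain ⟨δ', h₁, h₂, h₃⟩ := h (Pi.single i δ) fun s hs j => by
      rcases eq_or_ne j i with rfl | hj
      · simpa using hδ s hs
      · simp [hj, zero_mem]
    exact ⟨δ' i, fun s hs => h₁ s hs i, h₂ i, by simpa using h₃ i⟩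
  · intro h δ hδ
    choose δ' h₁ h₂ h₃ using fun i => h i (δ i) fun s hs => hδ s hs i
    exact ⟨δ', fun s hs i => h₁ i s hs, h₂, h₃⟩

/-- Traversal of an edge in the opposite direction. -/
def EdgeKind.reverse : EdgeKind → EdgeKind
  | .out => .inn
  | .inn => .out
  | .bi => .bi
  | .und => .und

theorem EdgeKind.headAtTarget_reverse (k : EdgeKind) : k.reverse.HeadAtTarget ↔ k.HeadAtSource := by
  cases k <;> rfl

theorem EdgeKind.headAtSource_reverse (k : EdgeKind) : k.reverse.HeadAtSource ↔ k.HeadAtTarget := by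
  cases k <;> rfl

/-! ### Walks whose colliders are exactly their inner nodes in the conditioning set. -/

namespace MixedGraph

variable {V : Type*} {G : MixedGraph V}

theorem Has.reverse {k : EdgeKind} {u v : V} (h : G.Has k u v) : G.Has k.reverse v u := by
  cases k
  · exact h
  · exact h
  · exact G.bi_symm _ _ h
  · exact G.und_symm _ _ h

/-- Open walks in which the colliders are exactly the inner nodes in `S`. -/
inductive StrictWalk (G : MixedGraph V) (S : Finset V) (u : V) : V → EdgeKind → V → Prop
  | single {k : EdgeKind} {v : V} : G.Has k u v → StrictWalk G S u u k v
  | step {a : V} {k : EdgeKind} {v : V} {l : EdgeKind} {b : V} :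
      StrictWalk G S u a k v → G.Has l v b → (k.HeadAtTarget ∧ l.HeadAtSource ↔ v ∈ S) →
        StrictWalk G S u v l b

/-- From a node with a descendant in `S` a strict walk can descend to `S` and return. -/
theorem StrictWalk.detour {S : Finset V} {u v s : V} (hs : s ∈ S) (hv : G.Ancestor v s) :
    ∀ {a k}, G.StrictWalk S u a k v → v ∈ S ∨ ∃ w, G.StrictWalk S u w .inn v := by
  induction hv using Relation.ReflTransGen.head_induction_on with
  | refl => exact fun _ => Or.inl hs
  | @head v w hvw _ ih =>
    intro a k h
    by_cases hvS : v ∈ S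
    · exact Or.inl hvS
    have h' : G.StrictWalk S u v .out w := h.step hvw (by simp [EdgeKind.HeadAtSource, hvS])
    refine Or.inr ⟨w, ?_⟩
    by_cases hwS : w ∈ S
    · exact h'.step (l := .inn) hvw
        (by simp [EdgeKind.HeadAtSource, EdgeKind.HeadAtTarget, hwS])
    · obtain ⟨w', hw'⟩ := (ih h').resolve_left hwS
      exact hw'.step (l := .inn) hvw (by simp [EdgeKind.HeadAtTarget, hwS])

/-- At an open collider outside `S`, insert a descent to the first descendant in `S` on a directed
path, and return. The turning point is a collider in `S`, and the original node is now passed twice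
as a non-collider. -/
theorem OpenWalk.strictWalk {S : Finset V} {u a v : V} {k : EdgeKind}
    (h : G.OpenWalk .m S u a k v) : G.StrictWalk S u a k v := by
  induction h with
  | single h => exact .single h
  | @step a k v l b _ hl ho ih =>
    rcases ho with ⟨hk, hl', s, hs, hvs⟩ | ⟨hn, hb⟩
    · by_cases hvS : v ∈ S
      · exact ih.step hl (by simp [hk, hl', hvS])
      · obtain ⟨w, hw⟩ := (ih.detour hs hvs).resolve_left hvS
        exact hw.step hl (by simp [EdgeKind.HeadAtTarget, hvS])
    · have hvS : v ∉ S := hb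
      exact ih.step hl (by simp [hn, hvS])

/-- A walk with `n` edges, given by the sequences of its nodes and of the kinds of its edges. -/
structure IsWalk (G : MixedGraph V) (n : ℕ) (p : ℕ → V) (κ : ℕ → EdgeKind) : Prop where
  has : ∀ i < n, G.Has (κ i) (p i) (p (i + 1))

/-- The inner position `q` of a walk is a collider. -/
def ColliderAt (κ : ℕ → EdgeKind) (q : ℕ) : Prop :=
  (κ (q - 1)).HeadAtTarget ∧ (κ q).HeadAtSource

theorem StrictWalk.exists_isWalk {S : Finset V} {u a v : V} {k : EdgeKind}
    (h : G.StrictWalk S u a k v) :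
    ∃ n p κ, G.IsWalk (n + 1) p κ ∧ p 0 = u ∧ p n = a ∧ p (n + 1) = v ∧ κ n = k ∧
      ∀ q, 0 < q → q ≤ n → (ColliderAt κ q ↔ p q ∈ S) := by
  induction h with
  | @single k v h =>
    refine ⟨0, fun i => if i = 0 then u else v, fun _ => k, ⟨fun i hi => ?_⟩, by simp, by simp,
      by simp, rfl, fun q h₀ h₁ => by omega⟩
    obtain rfl : i = 0 := by omega
    simpa using h
  | @step a k v l b _ hl ho ih =>
    obtain ⟨n, p, κ, hw, h0, hn, hn1, hk, hS⟩ := ih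
    refine ⟨n + 1, fun i => if i ≤ n + 1 then p i else b, fun i => if i ≤ n then κ i else l,
      ⟨fun i hi => ?_⟩, by simp [h0], by simp [hn1], by simp, by simp, fun q h₀ h₁ => ?_⟩
    · rcases Nat.lt_or_ge i (n + 1) with hi' | hi'
      · have := hw.has i hi'
        simpa [show i ≤ n by omega, show i ≤ n + 1 by omega] using this
      · obtain rfl : i = n + 1 := by omega
        simpa [hn1] using hl
    · rcases Nat.lt_or_ge q (n + 1) with hq | hq
      · have := hS q h₀ (by omega)
        simpa [ColliderAt, show q ≤ n by omega, show q ≤ n + 1 by omega,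
          show q - 1 ≤ n by omega] using this
      · obtain rfl : q = n + 1 := by omega
        simpa [ColliderAt, hn1, hk] using ho

section Walk

variable {n : ℕ} {p : ℕ → V} {κ : ℕ → EdgeKind} {C : Finset V}

theorem IsWalk.openWalk_forward (hw : G.IsWalk n p κ) {j : ℕ} : ∀ i, j ≤ i → i < n →
    (∀ q, j < q → q ≤ i → (ColliderAt κ q ↔ p q ∈ C)) →
      G.OpenWalk .m C (p j) (p i) (κ i) (p (i + 1)) := by
  intro i hij
  induction i, hij using Nat.le_induction with
  | base => exact fun hj _ => .single (hw.has j hj)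
  | succ i hij ih =>
    intro hi ho
    refine (ih (by omega) fun q h₁ h₂ => ho q h₁ (by omega)).step (hw.has _ hi) ?_
    have := ho (i + 1) (by omega) le_rfl
    simp only [ColliderAt, Nat.add_sub_cancel] at this
    by_cases hc : p (i + 1) ∈ C
    · exact Or.inl ⟨(this.2 hc).1, (this.2 hc).2, _, hc, .refl⟩
    · exact Or.inr ⟨fun h => hc (this.1 h), hc⟩

/-- Reversing a stretch keeps its colliders. Here `d` counts the inner positions between `i` and
`j`. -/
theorem IsWalk.openWalk_backward (hw : G.IsWalk n p κ) {j : ℕ} (hj : j ≤ n) : ∀ d i, i + d + 1 = j →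
    (∀ q, i < q → q < j → (ColliderAt κ q ↔ p q ∈ C)) →
      G.OpenWalk .m C (p j) (p (i + 1)) (κ i).reverse (p i) := by
  intro d
  induction d with
  | zero =>
    rintro i rfl _
    exact .single (hw.has i (by omega)).reverse
  | succ d ih =>
    intro i hi ho
    refine (ih (i + 1) (by omega) fun q h₁ h₂ => ho q (by omega) h₂).step
      (hw.has i (by omega)).reverse ?_
    have := ho (i + 1) (by omega) (by omega)
    simp only [ColliderAt, Nat.add_sub_cancel] at this
    rw [SegmentOpen, EdgeKind.headAtTarget_reverse, EdgeKind.headAtSource_reverse]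
    by_cases hc : p (i + 1) ∈ C
    · exact Or.inl ⟨(this.2 hc).2, (this.2 hc).1, _, hc, .refl⟩
    · exact Or.inr ⟨fun h => hc (this.1 h.symm), hc⟩

end Walk

/-! ### The group of edge labels of a walk and the variables observed at its nodes. -/

/-- Labellings of the edges of a walk with `n` edges that are constant along non-colliders. -/
def walkLabels (n : ℕ) (κ : ℕ → EdgeKind) : AddSubgroup (ℕ → ZMod 2) where
  carrier := {β | (∀ i, n ≤ i → β i = 0) ∧
    ∀ q, 0 < q → q < n → ¬ ColliderAt κ q → β (q - 1) = β q}
  zero_mem' := by simp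
  add_mem' := fun {a b} ha hb => ⟨fun i hi => by simp [ha.1 i hi, hb.1 i hi],
    fun q h₀ h₁ h₂ => by simp [ha.2 q h₀ h₁ h₂, hb.2 q h₀ h₁ h₂]⟩
  neg_mem' := fun {a} ha => ⟨fun i hi => by simp [ha.1 i hi],
    fun q h₀ h₁ h₂ => by simp [ha.2 q h₀ h₁ h₂]⟩

instance walkLabels_finite (n : ℕ) (κ : ℕ → EdgeKind) : Finite (walkLabels n κ) := by
  refine Finite.of_injective (fun (β : walkLabels n κ) (i : Fin n) => β.1 i) fun β β' h => ?_
  ext i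
  rcases Nat.lt_or_ge i n with hi | hi
  · exact congrFun h ⟨i, hi⟩
  · rw [β.2.1 i hi, β'.2.1 i hi]

/-- The labellings for which the values observed at `v` vanish: at the positions of `v` that are
colliders the two labels agree, at the others they are zero. -/
def walkKernel (n : ℕ) (p : ℕ → V) (κ : ℕ → EdgeKind) (v : V) : AddSubgroup (walkLabels n κ) where
  carrier := {β | ∀ q ≤ n, p q = v →
    (0 < q → q < n → ColliderAt κ q → β.1 (q - 1) = β.1 q) ∧
    (¬ (0 < q ∧ q < n ∧ ColliderAt κ q) → β.1 (q - 1) = 0 ∧ β.1 q = 0)}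
  zero_mem' := by simp
  add_mem' := fun {a b} ha hb q hq hv =>
    ⟨fun h₀ h₁ h₂ => by simp [(ha q hq hv).1 h₀ h₁ h₂, (hb q hq hv).1 h₀ h₁ h₂],
      fun h => by simp [(ha q hq hv).2 h, (hb q hq hv).2 h]⟩
  neg_mem' := fun {a} ha q hq hv =>
    ⟨fun h₀ h₁ h₂ => by simp [(ha q hq hv).1 h₀ h₁ h₂], fun h => by simp [(ha q hq hv).2 h]⟩

/-- The endpoints of a strict walk are dependent. -/
theorem not_subgroupsSplit_walkKernel {n : ℕ} {p : ℕ → V} {κ : ℕ → EdgeKind} {t : Stmt V}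
    (h0 : p 0 = t.x) (hn : p (n + 1) = t.y)
    (hS : ∀ q, 0 < q → q ≤ n → (ColliderAt κ q ↔ p q ∈ t.S)) :
    ¬ SubgroupsSplit (walkKernel (n + 1) p κ) t := by
  intro h
  have hend : ∀ q ≤ n + 1, p q ∈ t.S → 0 < q ∧ q ≤ n := by
    intro q hq hqS
    constructor
    · rcases Nat.eq_zero_or_pos q with rfl | h'
      · exact absurd (h0 ▸ hqS) t.x_notMem
      · exact h'
    · by_contra h'
      obtain rfl : q = n + 1 := by omega
      exact absurd (hn ▸ hqS) t.y_notMem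
  -- Test the constant labelling `1`. Membership of `δ'` in the kernels of `S` makes it constant
  -- across colliders too, but it must be `0` at the `y`-end and `1` at the `x`-end.
  obtain ⟨δ', h₁, h₂, h₃⟩ := h ⟨fun i => if i < n + 1 then 1 else 0,
    fun i hi => by simp [show ¬ i < n + 1 by omega],
    fun q _ hq _ => by simp [hq, show q - 1 < n + 1 by omega]⟩ (by
      rintro s hs q hq rfl
      obtain ⟨hq₀, hq₁⟩ := hend q hq hs
      refine ⟨fun _ _ _ => by simp [show q < n + 1 by omega, show q - 1 < n + 1 by omega],
        fun hc => absurd ⟨hq₀, by omega, (hS q hq₀ hq₁).2 hs⟩ hc⟩)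
  have hconst : ∀ q ≤ n, δ'.1 q = δ'.1 0 := by
    intro q
    induction q with
    | zero => exact fun _ => rfl
    | succ q ih =>
      intro hq
      rw [← ih (by omega)]
      by_cases hc : ColliderAt κ (q + 1)
      · exact ((h₁ _ ((hS _ (by omega) hq).1 hc) (q + 1) (by omega) rfl).1 (by omega) (by omega)
          hc).symm
      · exact (δ'.2.2 (q + 1) (by omega) (by omega) hc).symm
  have e₁ := ((h₂ (n + 1) le_rfl hn).2 (by simp)).1
  have e₂ := ((h₃ 0 (by omega) h0).2 (by simp)).1
  simp only [Nat.add_sub_cancel, hconst n le_rfl] at e₁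
  simp [e₁] at e₂

/-- The distribution associated with a walk is Markovian. -/
theorem IsWalk.subgroupsSplit_walkKernel {n : ℕ} {p : ℕ → V} {κ : ℕ → EdgeKind}
    (hw : G.IsWalk n p κ) {t : Stmt V} (ht : G.Sep .m t) :
    SubgroupsSplit (walkKernel n p κ) t := by
  classical
  intro δ hδ
  -- `R i`: edge `i` is linked to an occurrence of `x`, on its left or right, by a stretch of the
  -- walk that is open given `S`. All edges at `x` satisfy `R`; an edge at `y` satisfying it would
  -- give an open walk from `x` to `y`.
  set R : ℕ → Prop := fun i =>
    (∃ j ≤ i, p j = t.x ∧ ∀ q, j < q → q ≤ i → (ColliderAt κ q ↔ p q ∈ t.S)) ∨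
    (∃ j, i < j ∧ j ≤ n ∧ p j = t.x ∧ ∀ q, i < q → q < j → (ColliderAt κ q ↔ p q ∈ t.S)) with hR
  have hstep : ∀ q, 0 < q → q < n → (ColliderAt κ q ↔ p q ∈ t.S) → (R (q - 1) ↔ R q) := by
    intro q h₀ h₁ ho
    constructor
    · rintro (⟨j, hj, hx, hq⟩ | ⟨j, hj, hjn, hx, hq⟩)
      · refine Or.inl ⟨j, by omega, hx, fun r hr hr' => ?_⟩
        rcases eq_or_ne r q with rfl | hne
        · exact ho
        · exact hq r hr (by omega)
      · rcases eq_or_ne j q with rfl | hne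
        · exact Or.inl ⟨j, le_rfl, hx, fun r _ _ => by omega⟩
        · exact Or.inr ⟨j, by omega, hjn, hx, fun r hr hr' => hq r (by omega) hr'⟩
    · rintro (⟨j, hj, hx, hq⟩ | ⟨j, hj, hjn, hx, hq⟩)
      · rcases eq_or_ne j q with rfl | hne
        · exact Or.inr ⟨j, by omega, by omega, hx, fun r _ _ => by omega⟩
        · exact Or.inl ⟨j, by omega, hx, fun r hr hr' => hq r hr (by omega)⟩
      · refine Or.inr ⟨j, by omega, hjn, hx, fun r hr hr' => ?_⟩
        rcases eq_or_ne r q with rfl | hne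
        · exact ho
        · exact hq r (by omega) hr'
  have hRx : ∀ q ≤ n, p q = t.x → R q ∧ (0 < q → R (q - 1)) := fun q hq hx =>
    ⟨Or.inl ⟨q, le_rfl, hx, fun r _ _ => by omega⟩,
      fun h => Or.inr ⟨q, by omega, hq, hx, fun r _ _ => by omega⟩⟩
  have hRy : ∀ q ≤ n, p q = t.y → (q < n → ¬ R q) ∧ (0 < q → ¬ R (q - 1)) := by
    intro q hq hy
    constructor
    · rintro hqn (⟨j, hj, hx, ho⟩ | ⟨j, hj, hjn, hx, ho⟩)
      · rcases eq_or_ne j q with rfl | hne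
        · exact t.ne (hx.symm.trans hy)
        · have := hw.openWalk_forward (C := t.S) (j := j) (q - 1) (by omega) (by omega)
            fun r h₁ h₂ => ho r h₁ (by omega)
          rw [Nat.sub_add_cancel (by omega), hx, hy] at this
          exact ht ⟨_, _, this⟩
      · have := hw.openWalk_backward hjn (j - q - 1) q (by omega) ho
        rw [hx, hy] at this
        exact ht ⟨_, _, this⟩
    · rintro hq₀ (⟨j, hj, hx, ho⟩ | ⟨j, hj, hjn, hx, ho⟩)
      · have := hw.openWalk_forward (C := t.S) (j := j) (q - 1) hj (by omega) ho
        rw [Nat.sub_add_cancel (by omega), hx, hy] at this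
        exact ht ⟨_, _, this⟩
      · rcases eq_or_ne j q with rfl | hne
        · exact t.ne (hx.symm.trans hy)
        · have := hw.openWalk_backward (C := t.S) hjn (j - q - 1) q (by omega)
            fun r h₁ h₂ => ho r (by omega) h₂
          rw [hx, hy] at this
          exact ht ⟨_, _, this⟩
  -- Take `δ'` to be `δ` cut off outside `R`. The cut is harmless: `R` changes only at non-colliders
  -- in `S`, where both labels of `δ` vanish, or at colliders outside `S`, where no constraint links
  -- the labels.
  refine ⟨⟨fun i => if R i then δ.1 i else 0, fun i hi => by simp [δ.2.1 i hi],
    fun q h₀ h₁ hc => ?_⟩, ?_, ?_, ?_⟩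
  · by_cases hqS : p q ∈ t.S
    · obtain ⟨e₁, e₂⟩ := (hδ _ hqS q h₁.le rfl).2 (by simp [hc])
      simp [e₁, e₂]
    · simp [hstep q h₀ h₁ (by simp [hc, hqS]), δ.2.2 q h₀ h₁ hc]
  · rintro s hs q hq rfl
    have := hδ _ hs q hq rfl
    refine ⟨fun h₀ h₁ hc => ?_, fun hc => ?_⟩
    · simp [hstep q h₀ h₁ (by simp [hc, hs]), this.1 h₀ h₁ hc]
    · simp [this.2 hc]
  · intro q hq hy
    obtain ⟨h₁, h₂⟩ := hRy q hq hy
    have e₁ : (if R q then δ.1 q else 0) = 0 := by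
      rcases Nat.lt_or_ge q n with h | h
      · simp [h₁ h]
      · simp [δ.2.1 q h]
    have e₂ : (if R (q - 1) then δ.1 (q - 1) else 0) = 0 := by
      rcases Nat.eq_zero_or_pos q with rfl | h
      · exact e₁
      · simp [h₂ h]
    exact ⟨fun _ _ _ => e₂.trans e₁.symm, fun _ => ⟨e₂, e₁⟩⟩
  · intro q hq hx
    obtain ⟨h₁, h₂⟩ := hRx q hq hx
    have e₁ : δ.1 q - (if R q then δ.1 q else 0) = 0 := by simp [h₁]
    have e₂ : δ.1 (q - 1) - (if R (q - 1) then δ.1 (q - 1) else 0) = 0 := by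
      rcases Nat.eq_zero_or_pos q with rfl | h
      · exact e₁
      · simp [h₂ h]
    exact ⟨fun _ _ _ => e₂.trans e₁.symm, fun _ => ⟨e₂, e₁⟩⟩

theorem exists_subgroupsSplit_of_sep (G : MixedGraph V) (t : Stmt V) :
    ∃ (n : ℕ) (p : ℕ → V) (κ : ℕ → EdgeKind),
      (∀ t', G.Sep .m t' → SubgroupsSplit (walkKernel n p κ) t') ∧
        (SubgroupsSplit (walkKernel n p κ) t → G.Sep .m t) := by
  by_cases ht : G.Sep .m t
  -- For a separated tuple nothing has to be made dependent, and the walk without edges has a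
  -- trivial label group.
  · exact ⟨0, fun _ => t.x, fun _ => .bi,
      fun t' ht' => IsWalk.subgroupsSplit_walkKernel ⟨fun i hi => by omega⟩ ht', fun _ => ht⟩
  · obtain ⟨a, k, h⟩ := not_not.1 ht
    obtain ⟨n, p, κ, hw, h0, -, hn, -, hS⟩ := h.strictWalk.exists_isWalk
    exact ⟨n + 1, p, κ, fun t' ht' => hw.subgroupsSplit_walkKernel ht',
      fun h => absurd h (not_subgroupsSplit_walkKernel h0 hn hS)⟩

/-- Every mixed graph has a distribution that is Markovian and faithful for `m`-separation. -/
theorem exists_condIndepIn_iff_sep_m [Fintype V] (G : MixedGraph V) :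
    ∃ P : ProbabilityMeasure (V → ℝ), ∀ t, CondIndepIn P t ↔ G.Sep .m t := by
  have := Stmt.finite V
  choose n p κ hM hF using G.exists_subgroupsSplit_of_sep
  refine ⟨cosetDist fun v => AddSubgroup.pi Set.univ fun t => walkKernel (n t) (p t) (κ t) v,
    fun t => ?_⟩
  rw [condIndepIn_cosetDist_iff,
    subgroupsSplit_pi_iff (K := fun t v => walkKernel (n t) (p t) (κ t) v)]
  exact ⟨fun h => hF t (h t), fun h t' => hM t' t h⟩

end MixedGraph

/-! ### Acyclification: from `σ`-separation to `m`-separation -/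

namespace MixedGraph

variable {V : Type*} {G : MixedGraph V} {S : Finset V}

theorem SameSCC.refl (v : V) : G.SameSCC v v := ⟨.refl, .refl⟩

theorem SameSCC.symm {u v : V} (h : G.SameSCC u v) : G.SameSCC v u := ⟨h.2, h.1⟩

theorem SameSCC.trans {u v w : V} (h : G.SameSCC u v) (h' : G.SameSCC v w) : G.SameSCC u w :=
  ⟨.trans h.1 h'.1, .trans h'.2 h.2⟩

/-- The acyclification of `G`: a node points to all nodes of the strongly connected components of
its children other than its own, bidirected edges are extended to the strongly connected components
of their endpoints, and distinct nodes of a component are joined by bidirected edges. -/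
def acyclification (G : MixedGraph V) : MixedGraph V where
  dir u v := ¬ G.SameSCC u v ∧ ∃ v', G.SameSCC v v' ∧ G.dir u v'
  bi u v := u ≠ v ∧ ∃ u' v', G.SameSCC u u' ∧ G.SameSCC v v' ∧ (u' = v' ∨ G.bi u' v')
  und _ _ := False
  bi_symm := fun _ _ ⟨hne, u', v', hu, hv, h⟩ =>
    ⟨hne.symm, v', u', hv, hu, h.imp Eq.symm (G.bi_symm _ _)⟩
  und_symm := fun _ _ h => h
  bi_irrefl := fun _ h => h.1 rfl
  und_irrefl := fun _ h => h

theorem acyclification_bi_of_sameSCC {u v : V} (h : G.SameSCC u v) (hne : u ≠ v) :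
    G.acyclification.bi u v :=
  ⟨hne, v, v, h, .refl v, Or.inl rfl⟩

theorem ancestor_of_acyclification {u v : V} (h : G.acyclification.Ancestor u v) :
    G.Ancestor u v := by
  induction h with
  | refl => exact .refl
  | tail _ h ih =>
    obtain ⟨-, v', hv, hd⟩ := h
    exact (ih.tail hd).trans hv.2

/-- Edges inside a component are lost, so the start has to be replaced by the node from which the
path leaves the component. No further correction is needed, because an edge of the acyclification
enters every node of the target component. -/
theorem exists_acyclification_ancestor {v s : V} (h : G.Ancestor v s) :
    ∃ q, G.SameSCC v q ∧ G.acyclification.Ancestor q s := by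
  induction h using Relation.ReflTransGen.head_induction_on with
  | refl => exact ⟨s, .refl s, .refl⟩
  | @head v w hvw _ ih =>
    obtain ⟨q, hq, hqs⟩ := ih
    by_cases hs : G.SameSCC v w
    · exact ⟨q, hs.trans hq, hqs⟩
    · exact ⟨v, .refl v, .head ⟨fun h => hs (h.trans hq.symm), w, hq.symm, hvw⟩ hqs⟩

/-! #### Open walks of `G` give open walks of the acyclification -/

/-- `p` is the start of the walk or is reached by an edge with a tail at `p`. -/
def TailReach (G : MixedGraph V) (S : Finset V) (x p : V) : Prop :=
  p = x ∨ ∃ a, G.OpenWalk .m S x a .inn p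

/-- `q` is reached by an edge with an arrowhead at `q`. -/
def HeadReach (G : MixedGraph V) (S : Finset V) (x q : V) : Prop :=
  ∃ a k, k.HeadAtTarget ∧ G.OpenWalk .m S x a k q

theorem TailReach.step {x p b : V} {l : EdgeKind} (h : G.TailReach S x p) (hp : p ∉ S)
    (hl : G.Has l p b) : G.OpenWalk .m S x p l b := by
  rcases h with rfl | ⟨a, h⟩
  · exact .single hl
  · exact h.step hl (Or.inr ⟨fun h => h.1, hp⟩)

theorem HeadReach.step_of_notMem {x q b : V} {l : EdgeKind} (h : G.HeadReach S x q) (hq : q ∉ S)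
    (hl : G.Has l q b) (hs : ¬ l.HeadAtSource) : G.OpenWalk .m S x q l b := by
  obtain ⟨a, k, -, h⟩ := h
  exact h.step hl (Or.inr ⟨fun h => hs h.2, hq⟩)

theorem HeadReach.step_of_ancestor {x q s b : V} {l : EdgeKind} (h : G.HeadReach S x q)
    (hs : s ∈ S) (hqs : G.Ancestor q s) (hl : G.Has l q b) (hh : l.HeadAtSource) :
    G.OpenWalk .m S x q l b := by
  obtain ⟨a, k, hk, h⟩ := h
  exact h.step hl (Or.inl ⟨hk, hh, s, hs, hqs⟩)

/-- What an open walk of `G` from `x` with last edge `a -k- v` provides in the acyclification: either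
the component of `v` was entered (or started in) without an arrowhead, at a node `p`, or all its
nodes can be reached by an arrowhead. -/
def ComponentReach (G : MixedGraph V) (S : Finset V) (x a : V) (k : EdgeKind) (v : V) : Prop :=
  (∃ p, G.SameSCC v p ∧ G.acyclification.TailReach S x p ∧
      (p ∈ S → p = v ∧ k = .inn ∧ ¬ G.SameSCC v a)) ∨
    ((∀ q, G.SameSCC v q → G.acyclification.HeadReach S x q) ∧
      (k.HeadAtTarget ∨ ∃ s ∈ S, G.Ancestor v s))

/-- A step inside the component keeps `p`. When leaving by `←` or `↔`, `p` inherits the edge of `v`;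
when leaving by `→`, first move from `p` to `v` along a bidirected edge, if they differ, as `v`
itself is known to lie outside `S`. -/
theorem componentReach_of_tailReach (hG : G.IsDirectedMixed) {x v p b : V} {l : EdgeKind}
    (hvp : G.SameSCC v p) (hp : G.acyclification.TailReach S x p) (hpS : p ∉ S)
    (hl : G.Has l v b) (hv : l = .out → ¬ G.SameSCC v b → v ∉ S) :
    G.ComponentReach S x v l b := by
  by_cases hvb : G.SameSCC v b
  · exact Or.inl ⟨p, hvb.symm.trans hvp, hp, fun h => absurd h hpS⟩
  cases l with
  | out =>
    have hvS := hv rfl hvb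
    refine Or.inr ⟨fun q hq => ⟨v, .out, trivial, ?_⟩, Or.inl trivial⟩
    have hd : G.acyclification.Has .out v q :=
      ⟨fun h => hvb (h.trans hq.symm), b, hq.symm, hl⟩
    by_cases hpv : p = v
    · exact hpv ▸ hp.step hpS (hpv ▸ hd)
    · have hb : G.acyclification.Has .bi p v := acyclification_bi_of_sameSCC hvp.symm hpv
      exact HeadReach.step_of_notMem ⟨p, .bi, trivial, hp.step hpS hb⟩ hvS hd id
  | inn =>
    have hd : G.acyclification.Has .inn p b :=
      ⟨fun h => hvb (hvp.trans h.symm), v, hvp.symm, hl⟩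
    exact Or.inl ⟨b, .refl b, Or.inr ⟨p, hp.step hpS hd⟩,
      fun _ => ⟨rfl, rfl, fun h => hvb h.symm⟩⟩
  | bi =>
    refine Or.inr ⟨fun q hq => ⟨p, .bi, trivial, hp.step hpS ?_⟩, Or.inl trivial⟩
    refine ⟨?_, v, b, hvp.symm, hq.symm, Or.inr hl⟩
    rintro rfl
    exact hvb (hvp.trans hq.symm)
  | und => exact absurd hl (hG v b)

/-- Leaving against an arrowhead needs an open collider, provided by a node of the component that is
still an ancestor of `S` in the acyclification. Leaving by `→` uses `v` itself as a non-collider. -/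
theorem componentReach_of_headReach (hG : G.IsDirectedMixed) {x v b : V} {l : EdgeKind}
    (hr : ∀ q, G.SameSCC v q → G.acyclification.HeadReach S x q)
    (hs : l.HeadAtSource → ∃ s ∈ S, G.Ancestor v s)
    (hl : G.Has l v b) (hv : l = .out → ¬ G.SameSCC v b → v ∉ S) :
    G.ComponentReach S x v l b := by
  by_cases hvb : G.SameSCC v b
  · refine Or.inr ⟨fun q hq => hr q (hvb.trans hq), ?_⟩
    cases l with
    | out => exact Or.inl trivial
    | bi => exact Or.inl trivial
    | inn =>
      obtain ⟨s, hsS, hvs⟩ := hs trivial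
      exact Or.inr ⟨s, hsS, .trans hvb.2 hvs⟩
    | und => exact absurd hl (hG v b)
  cases l with
  | out =>
    refine Or.inr ⟨fun q hq => ⟨v, .out, trivial, ?_⟩, Or.inl trivial⟩
    exact (hr v (.refl v)).step_of_notMem (hv rfl hvb)
      ⟨fun h => hvb (h.trans hq.symm), b, hq.symm, hl⟩ id
  | inn =>
    obtain ⟨s, hsS, hvs⟩ := hs trivial
    obtain ⟨p, hvp, hps⟩ := exists_acyclification_ancestor hvs
    have hd : G.acyclification.Has .inn p b :=
      ⟨fun h => hvb (hvp.trans h.symm), v, hvp.symm, hl⟩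
    exact Or.inl ⟨b, .refl b, Or.inr ⟨p, (hr p hvp).step_of_ancestor hsS hps hd trivial⟩,
      fun _ => ⟨rfl, rfl, fun h => hvb h.symm⟩⟩
  | bi =>
    obtain ⟨s, hsS, hvs⟩ := hs trivial
    obtain ⟨p, hvp, hps⟩ := exists_acyclification_ancestor hvs
    refine Or.inr ⟨fun q hq => ⟨p, .bi, trivial, (hr p hvp).step_of_ancestor hsS hps ?_ trivial⟩,
      Or.inl trivial⟩
    refine ⟨?_, v, b, hvp.symm, hq.symm, Or.inr hl⟩
    rintro rfl
    exact hvb (hvp.trans hq.symm)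
  | und => exact absurd hl (hG v b)

theorem OpenWalk.componentReach (hG : G.IsDirectedMixed) {x a v : V} {k : EdgeKind} (hx : x ∉ S)
    (h : G.OpenWalk .sigma S x a k v) : G.ComponentReach S x a k v := by
  induction h with
  | single h => exact componentReach_of_tailReach hG (.refl x) (Or.inl rfl) hx h fun _ _ => hx
  | @step a k v l b _ hl ho ih =>
    have hv : l = .out → ¬ G.SameSCC v b → v ∉ S := by
      rintro rfl hvb hvS
      rcases ho with ⟨-, h, -⟩ | ⟨-, h⟩
      · exact h
      · exact h ⟨hvS, Or.inr ⟨rfl, hvb⟩⟩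
    rcases ih with ⟨p, hvp, hp, hpS⟩ | ⟨hr, hk⟩
    · refine componentReach_of_tailReach hG hvp hp (fun h => ?_) hl hv
      obtain ⟨rfl, rfl, hpa⟩ := hpS h
      rcases ho with ⟨h', -⟩ | ⟨-, h'⟩
      · exact h'
      · exact h' ⟨h, Or.inl ⟨rfl, hpa⟩⟩
    · refine componentReach_of_headReach hG hr (fun hh => ?_) hl hv
      rcases hk with hk | hk
      · rcases ho with ⟨-, -, h⟩ | ⟨h, -⟩
        · exact h
        · exact absurd ⟨hk, hh⟩ h
      · exact hk

/-! #### Open walks of the acyclification give open walks of `G` -/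

/-- Following directed edges within a component never blocks: every inner node is a non-collider
whose only outgoing edge on its segment stays in the component. -/
theorem OpenWalk.forward_in_component {x c b : V} (hcb : G.SameSCC c b) : ∀ {a k},
    G.OpenWalk .sigma S x a k c → k.HeadAtTarget →
      ∃ a' k', G.OpenWalk .sigma S x a' k' b ∧ k'.HeadAtTarget := by
  obtain ⟨h, hbc⟩ := hcb
  induction h using Relation.ReflTransGen.head_induction_on with
  | refl => exact fun h hk => ⟨_, _, h, hk⟩
  | @head c d hcd hdb ih =>
    intro a k h hk
    refine ih (hbc.tail hcd) (h.step (l := .out) hcd (Or.inr ⟨fun h => h.2, ?_⟩)) trivial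
    rintro ⟨-, ⟨rfl, -⟩ | ⟨-, h'⟩⟩
    · exact hk
    · exact h' ⟨.single hcd, hdb.trans hbc⟩

theorem segmentOpen_sigma_of_inn {a v b : V} {l : EdgeKind} (hva : G.SameSCC v a)
    (hl : l = .out → G.SameSCC v b) : G.SegmentOpen .sigma S a .inn v l b := by
  refine Or.inr ⟨fun h => h.1, ?_⟩
  rintro ⟨-, ⟨-, h⟩ | ⟨h, h'⟩⟩
  · exact h hva
  · exact h' (hl h)

theorem OpenWalk.backward_in_component {x c d : V} (hcd : G.SameSCC c d) : ∀ {a},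
    G.OpenWalk .sigma S x a .inn c → G.SameSCC c a →
      ∃ a', G.OpenWalk .sigma S x a' .inn d ∧ G.SameSCC d a' := by
  obtain ⟨hcd, h⟩ := hcd
  induction h with
  | refl => exact fun h ha => ⟨_, h, ha⟩
  | @tail e c hde hec ih =>
    intro a h ha
    exact ih (.head hec hcd)
      (h.step (l := .inn) hec (segmentOpen_sigma_of_inn ha (by simp)))
      ⟨.single hec, .trans hcd hde⟩

/-- Inside a component one can leave `v` against an arrowhead and reach any other node `w`. -/
theorem exists_start_backward {v w : V} (hvw : G.SameSCC v w) (hne : v ≠ w) :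
    ∃ c, G.dir c v ∧ ∀ x, G.OpenWalk .sigma S x v .inn c →
      ∃ a, G.OpenWalk .sigma S x a .inn w ∧ G.SameSCC w a := by
  rcases Relation.ReflTransGen.cases_tail hvw.2 with rfl | ⟨c, hwc, hcv⟩
  · exact absurd rfl hne
  · have hc : G.SameSCC c v := ⟨.single hcv, .trans hvw.1 hwc⟩
    exact ⟨c, hcv, fun x h => h.backward_in_component (hc.trans hvw) hc⟩

/-- An edge of the acyclification is realized by an open walk of `G` with the same marks at its
ends. -/
theorem exists_realization {v b : V} {l : EdgeKind} (hl : G.acyclification.Has l v b) :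
    ∃ c l', G.Has l' v c ∧ (l'.HeadAtSource ↔ l.HeadAtSource) ∧
      ∀ x, G.OpenWalk .sigma S x v l' c →
        ∃ a k, G.OpenWalk .sigma S x a k b ∧ (k.HeadAtTarget ↔ l.HeadAtTarget) := by
  cases l with
  | out =>
    obtain ⟨-, b', hb, hd⟩ := hl
    refine ⟨b', .out, hd, Iff.rfl, fun x h => ?_⟩
    obtain ⟨a, k, h', hk⟩ := h.forward_in_component hb.symm trivial
    exact ⟨a, k, h', iff_of_true hk trivial⟩
  | inn =>
    obtain ⟨-, v', hv, hd⟩ := hl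
    by_cases hvv : v = v'
    · subst hvv
      exact ⟨b, .inn, hd, Iff.rfl, fun x h => ⟨v, .inn, h, Iff.rfl⟩⟩
    · obtain ⟨c, hc, hb⟩ := exists_start_backward hv hvv
      refine ⟨c, .inn, hc, Iff.rfl, fun x h => ?_⟩
      obtain ⟨a, h', ha⟩ := hb x h
      exact ⟨v', .inn, h'.step hd (segmentOpen_sigma_of_inn ha (by simp)), Iff.rfl⟩
  | bi =>
    obtain ⟨hne, v', b', hv, hb, rfl | hd⟩ := hl
    · have hvb := hv.trans hb.symm
      obtain ⟨c, hc, hback⟩ := exists_start_backward hvb hne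
      refine ⟨c, .inn, hc, Iff.rfl, fun x h => ?_⟩
      obtain ⟨a, h', ha⟩ := hback x h
      rcases Relation.ReflTransGen.cases_head hvb.2 with rfl | ⟨d, hbd, hdv⟩
      · exact absurd rfl hne
      · have hs : G.SameSCC b d := ⟨.single hbd, .trans hdv hvb.1⟩
        obtain ⟨a', k', h'', hk⟩ := (h'.step (l := .out) hbd
          (segmentOpen_sigma_of_inn ha fun _ => hs)).forward_in_component hs.symm trivial
        exact ⟨a', k', h'', iff_of_true hk trivial⟩
    · by_cases hvv : v = v'
      · subst hvv
        refine ⟨b', .bi, hd, Iff.rfl, fun x h => ?_⟩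
        obtain ⟨a, k, h', hk⟩ := h.forward_in_component hb.symm trivial
        exact ⟨a, k, h', iff_of_true hk trivial⟩
      · obtain ⟨c, hc, hback⟩ := exists_start_backward hv hvv
        refine ⟨c, .inn, hc, Iff.rfl, fun x h => ?_⟩
        obtain ⟨a, h', ha⟩ := hback x h
        obtain ⟨a', k', h'', hk⟩ := (h'.step (l := .bi) hd
          (segmentOpen_sigma_of_inn ha (by simp))).forward_in_component hb.symm trivial
        exact ⟨a', k', h'', iff_of_true hk trivial⟩
  | und => exact hl.elim

/-- Realizations keep the end marks, so the junctions keep their collider status; a non-collider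
outside `S` cannot block for `σ` either. -/
theorem OpenWalk.of_acyclification {x a v : V} {k : EdgeKind}
    (h : G.acyclification.OpenWalk .m S x a k v) :
    ∃ a' k', G.OpenWalk .sigma S x a' k' v ∧ (k'.HeadAtTarget ↔ k.HeadAtTarget) := by
  induction h with
  | single h =>
    obtain ⟨c, l', hl', -, hc⟩ := exists_realization h
    exact hc x (.single hl')
  | @step a k v l b _ hl ho ih =>
    obtain ⟨c, l', hl', hs, hc⟩ := exists_realization hl
    obtain ⟨a', k', h', hk⟩ := ih
    refine hc x (h'.step hl' ?_)
    rcases ho with ⟨h₁, h₂, s, hsS, hvs⟩ | ⟨h₁, h₂⟩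
    · exact Or.inl ⟨hk.2 h₁, hs.2 h₂, s, hsS, ancestor_of_acyclification hvs⟩
    · exact Or.inr ⟨fun h => h₁ ⟨hk.1 h.1, hs.1 h.2⟩, fun h => h₂ h.1⟩

/-- `σ`-separation in `G` is `m`-separation in the acyclification of `G`. -/
theorem sep_acyclification_iff (hG : G.IsDirectedMixed) (t : Stmt V) :
    G.acyclification.Sep .m t ↔ G.Sep .sigma t := by
  refine not_congr ⟨?_, ?_⟩
  · rintro ⟨a, k, h⟩
    obtain ⟨a', k', h', -⟩ := OpenWalk.of_acyclification h
    exact ⟨a', k', h'⟩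
  · rintro ⟨a, k, h⟩
    rcases h.componentReach hG t.x_notMem with ⟨p, hyp, hp, hpS⟩ | ⟨hr, -⟩
    -- `p ∈ S` would force `p = y`, but `y ∉ S`. Hence `p` can be left along its bidirected edge to
    -- `y` unless it already is `y`.
    · have hpS' : p ∉ t.S := fun h => t.y_notMem ((hpS h).1 ▸ h)
      by_cases hpy : p = t.y
      · rcases hp with hpx | ⟨a', h'⟩
        · exact absurd (hpx.symm.trans hpy) t.ne
        · exact ⟨a', .inn, hpy ▸ h'⟩
      · exact ⟨p, .bi, hp.step hpS' (acyclification_bi_of_sameSCC hyp.symm hpy)⟩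
    · obtain ⟨a', k', -, h'⟩ := hr t.y (.refl _)
      exact ⟨a', k', h'⟩

end MixedGraph

/-- Every graph of the class has a distribution that is Markovian and faithful. -/
theorem GraphClass.exists_condIndepIn_iff_sep {V : Type*} [Fintype V] (𝒦 : GraphClass V)
    {G : MixedGraph V} (hG : G ∈ 𝒦.graphs) :
    ∃ P : ProbabilityMeasure (V → ℝ), ∀ t, CondIndepIn P t ↔ 𝒦.Sep G t := by
  have hadm := 𝒦.admits G hG
  unfold GraphClass.Sep
  generalize 𝒦.type = τ at hadm
  cases τ with
  | dag => exact G.exists_condIndepIn_iff_sep_m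
  | mag => exact G.exists_condIndepIn_iff_sep_m
  | cyclic =>
    obtain ⟨P, hP⟩ := G.acyclification.exists_condIndepIn_iff_sep_m
    exact ⟨P, fun t => (hP t).trans (MixedGraph.sep_acyclification_iff hadm t)⟩

/-! ### Internally detectable errors -/

namespace Method

variable {V : Type*} {𝒦 : GraphClass V}

/-- A run of a method depends only on the outcomes of the performed tests. -/
theorem run_congr {ι ι' : Stmt V → Bool} (M : Method 𝒦) (h : ∀ t ∈ M.tested ι, ι t = ι' t) :
    M.tested ι' = M.tested ι ∧ M.out ι' = M.out ι := by
  induction M with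
  | output g => exact ⟨rfl, rfl⟩
  | test t p q ihp ihq =>
    have ht : ι t = ι' t := h t (Set.mem_insert _ _)
    simp only [tested, out, ← ht]
    by_cases hι : ι t = true
    · obtain ⟨h₁, h₂⟩ := ihp fun s hs => h s (by simp [tested, hι, hs])
      simp [hι, h₁, h₂]
    · obtain ⟨h₁, h₂⟩ := ihq fun s hs => h s (by simp [tested, hι, hs])
      simp [hι, h₁, h₂]

end Method

namespace GraphClass

variable {V : Type*} {𝒦 : GraphClass V}

theorem MEC.exists_mem (c : 𝒦.MEC) : ∃ G ∈ c.1, G ∈ 𝒦.graphs := by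
  obtain ⟨G, hG, hc⟩ := c.2
  exact ⟨G, hc ▸ ⟨hG, hG, fun _ => Iff.rfl⟩, hG⟩

theorem MEC.sep_iff_of_mem (c : 𝒦.MEC) {G H : MixedGraph V} (hG : G ∈ c.1) (hH : H ∈ c.1)
    (t : Stmt V) : 𝒦.Sep G t ↔ 𝒦.Sep H t := by
  obtain ⟨G₀, -, hc⟩ := c.2
  rw [hc] at hG hH
  exact (hG.2.2 t).symm.trans (hH.2.2 t)

end GraphClass

namespace MethodResult

variable {V : Type*} [Fintype V] {𝒦 : GraphClass V} {M : Method 𝒦} {r : MethodResult V}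

theorem ErrorFree.notMem_G1 (h : r.ErrorFree M) : r ∉ G1 M := by
  rintro ⟨g, hg⟩
  refine h.not_erroneous ?_
  rw [Erroneous, hg]
  trivial

theorem ErrorFree.notMem_G2 (h : r.ErrorFree M) : r ∉ G2 M := by
  rintro ⟨c, hc, hinc⟩
  have hmem : r.trueGraph ∈ c.1 := by
    have := h.not_erroneous
    rw [Erroneous, hc] at this
    exact not_not.1 this
  rcases hinc with hinc | hinc
  · refine hinc fun t ht G hG => (c.sep_iff_of_mem hmem hG t).1 ?_
    exact h.faithful t ((h.test_correct t).1 ht.2)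
  · refine hinc fun t ht G hG hsep => ?_
    have := (h.test_correct t).2 (h.markovian t ((c.sep_iff_of_mem hmem hG t).2 hsep))
    exact absurd (ht.2.symm.trans this) Bool.false_ne_true

/-- A coherent result without marks cannot be distinguished from some error-free result. -/
theorem exists_errorFree_of_coherent {c : 𝒦.MEC} (hc : r.outGraph M = .unmarked c)
    (hind : r.Tind M ⊆ c.sep) (hdep : r.Tdep M ⊆ c.con) :
    ∃ r' : MethodResult V, r'.ErrorFree M ∧ r'.Tind M = r.Tind M ∧ r'.Tdep M = r.Tdep M ∧
      r'.outGraph M = r.outGraph M := by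
  classical
  obtain ⟨G, hGc, hG⟩ := c.exists_mem
  obtain ⟨P, hP⟩ := 𝒦.exists_condIndepIn_iff_sep hG
  -- Coherence says precisely that the performed tests gave the answers of a separation oracle for
  -- `G`.
  have hι : ∀ t ∈ M.tested r.ciTest, r.ciTest t = decide (𝒦.Sep G t) := by
    intro t ht
    cases h : r.ciTest t with
    | true => exact (decide_eq_true (hind ⟨ht, h⟩ G hGc)).symm
    | false => exact (decide_eq_false (hdep ⟨ht, h⟩ G hGc)).symm
  obtain ⟨htested, hout⟩ := M.run_congr hι
  refine ⟨⟨G, P, fun t => decide (𝒦.Sep G t)⟩, ⟨hG, fun t => (hP t).2, fun t => (hP t).1,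
    fun t => by simp [hP t], ?_⟩, ?_, ?_, hout⟩
  · have : outGraph M ⟨G, P, fun t => decide (𝒦.Sep G t)⟩ = .unmarked c := hout.trans hc
    rw [Erroneous, this]
    exact not_not.2 hGc
  · ext t
    simp only [Tind, htested]
    exact and_congr_right fun ht => by rw [hι t ht]
  · ext t
    simp only [Tdep, htested]
    exact and_congr_right fun ht => by rw [hι t ht]

end MethodResult

theorem proposition2 {V : Type*} [Fintype V] (𝒦 : GraphClass V) (M : Method 𝒦) :
    {r : MethodResult V | r.InternallyDetectable M} =
      {r : MethodResult V | r.Erroneous M} ∩ (MethodResult.G1 M ∪ MethodResult.G2 M) := by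
  ext r
  constructor
  · rintro ⟨herr, D, hD, hfree⟩
    refine ⟨herr, ?_⟩
    cases hout : r.outGraph M with
    | marked g => exact Or.inl ⟨g, hout⟩
    | unmarked c =>
      refine Or.inr ⟨c, hout, ?_⟩
      by_contra! hcoh
      obtain ⟨r', hr', h₁, h₂, h₃⟩ :=
        MethodResult.exists_errorFree_of_coherent hout hcoh.1 hcoh.2
      exact hfree r' hr' (by rwa [h₁, h₂, h₃])
  · rintro ⟨herr, hG⟩
    refine ⟨herr, fun Ti Td g => (∃ g', g = .marked g') ∨
      ∃ c, g = .unmarked c ∧ (¬ Ti ⊆ c.sep ∨ ¬ Td ⊆ c.con), hG, ?_⟩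
    rintro r' hr' (h | h)
    · exact hr'.notMem_G1 h
    · exact hr'.notMem_G2 h
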